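/- Let $N\ge 1$. Let $\mathcal O(U_N^+)$ be the universal unital complex $*$-algebra generated by $u_{ij}$, $1\le i,j\le N$, such that $U=(u_{ij})$ and $\overline U=(u_{ij}^*)$ are unitary matrices, and let $\mathcal O(O_N^+)$ be its quotient by the relations $u_{ij}=u_{ij}^*$, the image of $u_{ij}$ being denoted $o_{ij}$. Both carry the coproduct $\Delta(u_{ij})=\sum_k u_{ik}\otimes u_{kj}$ and the counit $\varepsilon(u_{ij})=\delta_{ij}$. For $\mathbb G=O_N^+$ or $U_N^+$, a generating functional is a linear functional $L:\mathcal O(\mathbb G)\to\mathbb C$ that is hermitian ($L(a^*)=\overline{L(a)}$), vanishes at $1$ and satisfies $L(a^*a)\ge 0$ whenever $\varepsilon(a)=0$. It is Gaussian if for all $a,b,c$ $$L(abc)=L(ab)\varepsilon(c)+L(ac)\varepsilon(b)+L(bc)\varepsilon(a)-\varepsilon(ab)L(c)-\varepsilon(ac)L(b)-\varepsilon(bc)L(a).$$ A centralized Gaussian generating functional on $\mathbb G$ is a functional $L\circ\mathbb E$, where $L$ is a Gaussian generating functional and $\mathbb E$ is the conditional expectation, leaving the Haar state invariant, of $\mathcal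 O(\mathbb G)$ onto the subalgebra generated by the characters of the finite-dimensional representations. Define $\chi_n\in\mathcal O(O_N^+)$ by $\chi_0=1$, $\chi_1=\sum_j o_{jj}$, $\chi_1\chi_n=\chi_{n+1}+\chi_{n-1}$ for $n\ge1$, and polynomials by $P_0=1$, $P_1=X$, $XP_n=P_{n+1}+P_{n-1}$ for $n\ge 1$. For a word $w$ on the letters $\lozenge,\blacklozenge$, let $p(w)$ and $q(w)$ be the numbers of occurrences of $\lozenge$ and of $\blacklozenge$, let $\ell(w)=p(w)+q(w)$, and let $\chi_w\in\mathcal O(U_N^+)$ be the character of $U_w=U_{w_1}\otimes\dots\otimes U_{w_{\ell(w)}}$, where $U_\lozenge=U$ and $U_\blacklozenge=\overline U$. 1. For every centralized Gaussian generating functional $M$ on $O_N^+$ there is a real $b\ge0$ such that $M(\chi_n)=-bP_n'(N)$ for all $n\ge0$. 2. For every centralized Gaussian generating functional $M$ on $U_N^+$ there are $\alpha\in\mathbb C$ and a real $\beta\ge0$ with $\mathrm{Re}(\alpha)\ge\beta/N$ such that for every word $w$, writing $p,q,\ell$ for $p(w),q(w),\ell(w)$, $$M(\chi_w)=-(p\,\alpha+q\,\overline\alpha)N^{\ell-1}-\big((p-q)^2-\ell\big)N^{\ell-2}\beta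 .$$ If moreover $M(\chi_w)$ is real for every word $w$, then $\alpha$ is real, and thus $M(\chi_w)=-\ell N^{\ell-1}\alpha-\big((p-q)^2-\ell\big)N^{\ell-2}\beta$ for every word $w$. -/

import Mathlib

open scoped TensorProduct ComplexOrder ComplexConjugate

namespace FreeQG

/-- The two free quantum groups under consideration: `U_N^+` and `O_N^+`. -/
inductive Kind : Type
  | unitary
  | orthogonal

/-- The two letters of words: `plain` (a white diamond) stands for `U = (u_ij)`, `bar` (a black
diamond) stands for `(u_ij^*)`. -/
inductive Letter : Type
  | plain
  | bar
  deriving DecidableEq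

/-- The letter of the conjugate. -/
def Letter.flip : Letter → Letter
  | .plain => .bar
  | .bar => .plain

@[simp] theorem Letter.flip_flip (c : Letter) : c.flip.flip = c := by cases c <;> rfl

/-- Noncommutative polynomials in the letters `u_ij` (the generators `(plain, i, j)`) and `u_ij^*`
(the generators `(bar, i, j)`). -/
abbrev Free (N : ℕ) : Type := FreeAlgebra ℂ (Letter × Fin N × Fin N)

/-- The free generators. -/
noncomputable def fgen {N : ℕ} (c : Letter) (i j : Fin N) : Free N := FreeAlgebra.ι ℂ (c, i, j)

/-- The defining relations of `O(U_N^+)`: for both letters,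
`∑ k, u_ik u_jk^* = δ_ij = ∑ k, u_ki u_kj^*` and the same with `u` and `u^*` exchanged.
For `O(O_N^+)` one adds `u_ij^* = u_ij`. -/
inductive Rel (N : ℕ) (G : Kind) : Free N → Free N → Prop
  | row (c : Letter) (i j : Fin N) :
      Rel N G (∑ k, fgen c i k * fgen c.flip j k) (if i = j then 1 else 0)
  | col (c : Letter) (i j : Fin N) :
      Rel N G (∑ k, fgen c k i * fgen c.flip k j) (if i = j then 1 else 0)
  | real (h : G = Kind.orthogonal) (c : Letter) (i j : Fin N) :
      Rel N G (fgen c.flip i j) (fgen c i j)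

/-- The algebra `O(U_N^+)` for `G = unitary`, and `O(O_N^+)` for `G = orthogonal`. -/
def Pol (N : ℕ) (G : Kind) : Type := RingQuot (Rel N G)

noncomputable section

variable {N : ℕ} {G : Kind}

instance : Ring (Pol N G) := inferInstanceAs (Ring (RingQuot (Rel N G)))

instance : Algebra ℂ (Pol N G) := inferInstanceAs (Algebra ℂ (RingQuot (Rel N G)))

/-- The quotient map. -/
def mk (N : ℕ) (G : Kind) : Free N →ₐ[ℂ] Pol N G := RingQuot.mkAlgHom ℂ (Rel N G)

theorem mk_surjective : Function.Surjective (mk N G) := RingQuot.mkAlgHom_surjective ℂ (Rel N G)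

theorem mk_rel {x y : Free N} (h : Rel N G x y) : mk N G x = mk N G y :=
  RingQuot.mkAlgHom_rel ℂ h

/-- The generators of `Pol N G`: `gen plain i j = u_ij` and `gen bar i j = u_ij^*`. -/
def gen (c : Letter) (i j : Fin N) : Pol N G := mk N G (fgen c i j)

theorem gen_row (c : Letter) (i j : Fin N) :
    ∑ k, (gen c i k * gen c.flip j k : Pol N G) = if i = j then 1 else 0 := by
  have h := mk_rel (Rel.row (G := G) c i j)
  rw [apply_ite (mk N G), map_one, map_zero, map_sum] at h
  simpa [gen] using h

theorem gen_col (c : Letter) (i j : Fin N) :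
    ∑ k, (gen c k i * gen c.flip k j : Pol N G) = if i = j then 1 else 0 := by
  have h := mk_rel (Rel.col (G := G) c i j)
  rw [apply_ite (mk N G), map_one, map_zero, map_sum] at h
  simpa [gen] using h

theorem gen_real (h : G = Kind.orthogonal) (c : Letter) (i j : Fin N) :
    (gen c.flip i j : Pol N G) = gen c i j := mk_rel (Rel.real h c i j)

theorem pol_induction {P : Pol N G → Prop} (hc : ∀ r : ℂ, P (algebraMap ℂ _ r))
    (hg : ∀ c i j, P (gen c i j)) (hm : ∀ a b, P a → P b → P (a * b))
    (ha : ∀ a b, P a → P b → P (a + b)) (a : Pol N G) : P a := by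
  obtain ⟨x, rfl⟩ := mk_surjective a
  induction x using FreeAlgebra.induction with
  | grade0 r => rw [AlgHom.commutes]; exact hc r
  | grade1 x => exact hg x.1 x.2.1 x.2.2
  | mul a b h1 h2 => rw [map_mul]; exact hm _ _ h1 h2
  | add a b h1 h2 => rw [map_add]; exact ha _ _ h1 h2

/-- Universal property: values on the generators satisfying the relations extend to the algebra. -/
def polLift {B : Type*} [Ring B] [Algebra ℂ B] (f : Letter → Fin N → Fin N → B)
    (hrow : ∀ c i j, ∑ k, f c i k * f c.flip j k = if i = j then 1 else 0)
    (hcol : ∀ c i j, ∑ k, f c k i * f c.flip k j = if i = j then 1 else 0)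
    (hreal : G = Kind.orthogonal → ∀ c i j, f c.flip i j = f c i j) : Pol N G →ₐ[ℂ] B :=
  RingQuot.liftAlgHom ℂ
    ⟨FreeAlgebra.lift ℂ (fun x : Letter × Fin N × Fin N => f x.1 x.2.1 x.2.2), by
      intro x y h
      cases h with
      | row c i j =>
        rw [apply_ite (FreeAlgebra.lift ℂ _), map_one, map_zero]
        simpa [fgen] using hrow c i j
      | col c i j =>
        rw [apply_ite (FreeAlgebra.lift ℂ _), map_one, map_zero]
        simpa [fgen] using hcol c i j
      | real h c i j => simpa [fgen] using hreal h c i j⟩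

@[simp] theorem polLift_gen {B : Type*} [Ring B] [Algebra ℂ B] (f : Letter → Fin N → Fin N → B)
    (hrow hcol hreal) (c : Letter) (i j : Fin N) :
    polLift (G := G) f hrow hcol hreal (gen c i j) = f c i j := by
  unfold polLift gen mk
  erw [RingQuot.liftAlgHom_mkAlgHom_apply]
  simp [fgen]

theorem pol_hom_ext {B : Type*} [Ring B] [Algebra ℂ B] {f g : Pol N G →ₐ[ℂ] B}
    (h : ∀ c i j, f (gen c i j) = g (gen c i j)) : f = g := by
  ext a
  induction a using pol_induction with
  | hc r => simp
  | hg c i j => exact h c i j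
  | hm a b h1 h2 => simp [h1, h2]
  | ha a b h1 h2 => simp [h1, h2]

/-! The involution: the conjugate-linear anti-multiplicative map exchanging `u_ij` and `u_ij^*`. -/

/-- The opposite algebra of `Pol N G` with the conjugate complex structure. -/
def ConjOp (N : ℕ) (G : Kind) : Type := (Pol N G)ᵐᵒᵖ

instance : Ring (ConjOp N G) := inferInstanceAs (Ring (Pol N G)ᵐᵒᵖ)

instance : Algebra ℂ (ConjOp N G) :=
  RingHom.toAlgebra' ((algebraMap ℂ (Pol N G)ᵐᵒᵖ).comp (starRingEnd ℂ))
    (fun c x => Algebra.commutes (A := (Pol N G)ᵐᵒᵖ) (starRingEnd ℂ c) x)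

/-- Reading an element of `Pol N G` in the conjugate opposite algebra. -/
def toConj : Pol N G ≃+ ConjOp N G := MulOpposite.opAddEquiv

theorem toConj_mul (a b : Pol N G) : toConj (a * b) = toConj b * toConj a := rfl

theorem toConj_one : toConj (1 : Pol N G) = 1 := rfl

theorem toConj_algebraMap (r : ℂ) :
    toConj (algebraMap ℂ (Pol N G) (conj r)) = algebraMap ℂ (ConjOp N G) r := rfl

/-- The involution, as a homomorphism to the conjugate opposite algebra. -/
def starHom (N : ℕ) (G : Kind) : Pol N G →ₐ[ℂ] ConjOp N G :=
  polLift (fun c i j => toConj (gen c.flip i j))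
    (fun c i j => by
      have h := congrArg (toConj (N := N) (G := G)) (gen_row (G := G) c j i)
      rw [map_sum, apply_ite (toConj (N := N) (G := G)), toConj_one, map_zero] at h
      simpa [toConj_mul, eq_comm] using h)
    (fun c i j => by
      have h := congrArg (toConj (N := N) (G := G)) (gen_col (G := G) c j i)
      rw [map_sum, apply_ite (toConj (N := N) (G := G)), toConj_one, map_zero] at h
      simpa [toConj_mul, eq_comm] using h)
    (fun h c i j => by rw [gen_real h])

instance : Star (Pol N G) := ⟨fun a => toConj.symm (starHom N G a)⟩

theorem star_def (a : Pol N G) : star a = toConj.symm (starHom N G a) := rfl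

@[simp] theorem star_gen (c : Letter) (i j : Fin N) :
    star (gen c i j : Pol N G) = gen c.flip i j := by
  simp [star_def, starHom]

theorem star_mul_aux (a b : Pol N G) : star (a * b) = star b * star a := by
  rw [star_def, map_mul]; rfl

theorem star_add_aux (a b : Pol N G) : star (a + b) = star a + star b := by
  simp [star_def]

theorem star_algebraMap_aux (r : ℂ) :
    star (algebraMap ℂ (Pol N G) r) = algebraMap ℂ (Pol N G) (conj r) := by
  rw [star_def, AlgHom.commutes, ← toConj_algebraMap, AddEquiv.symm_apply_apply]

instance : StarRing (Pol N G) where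
  star_involutive a := by
    induction a using pol_induction with
    | hc r => simp [star_algebraMap_aux]
    | hg c i j => simp
    | hm a b h1 h2 => rw [star_mul_aux, star_mul_aux, h1, h2]
    | ha a b h1 h2 => rw [star_add_aux, star_add_aux, h1, h2]
  star_mul := star_mul_aux
  star_add := star_add_aux

instance : StarModule ℂ (Pol N G) where
  star_smul r a := by
    rw [Algebra.smul_def, star_mul, star_algebraMap_aux, ← Algebra.commutes, ← Algebra.smul_def]
    rfl

/-! The coproduct `Δ(u_ij) = ∑ k, u_ik ⊗ u_kj` and the counit `ε(u_ij) = δ_ij`. -/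

theorem delta_tmul (P : Prop) [Decidable P] :
    ((if P then 1 else 0 : Pol N G) ⊗ₜ[ℂ] (1 : Pol N G)) = if P then 1 else 0 := by
  split_ifs
  · rfl
  · simp

theorem tmul_delta (P : Prop) [Decidable P] :
    ((1 : Pol N G) ⊗ₜ[ℂ] (if P then 1 else 0 : Pol N G)) = if P then 1 else 0 := by
  split_ifs
  · rfl
  · simp

theorem comul_row (c : Letter) (i j : Fin N) :
    ∑ k, (∑ a, (gen c i a : Pol N G) ⊗ₜ[ℂ] (gen c a k : Pol N G)) *
      (∑ b, (gen c.flip j b : Pol N G) ⊗ₜ[ℂ] (gen c.flip b k : Pol N G))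
      = if i = j then 1 else 0 := by
  simp only [Finset.sum_mul_sum, Algebra.TensorProduct.tmul_mul_tmul]
  rw [Finset.sum_comm]
  have h : ∀ a : Fin N, ∑ k, ∑ b, ((gen c i a * gen c.flip j b : Pol N G) ⊗ₜ[ℂ]
      (gen c a k * gen c.flip b k : Pol N G)) = (gen c i a * gen c.flip j a) ⊗ₜ[ℂ] 1 := by
    intro a
    rw [Finset.sum_comm, Finset.sum_eq_single a]
    · rw [← TensorProduct.tmul_sum, gen_row, if_pos rfl]
    · intro b _ hb
      rw [← TensorProduct.tmul_sum, gen_row, if_neg hb.symm, TensorProduct.tmul_zero]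
    · simp
  rw [Finset.sum_congr rfl fun a _ => h a, ← TensorProduct.sum_tmul, gen_row, delta_tmul]

theorem comul_col (c : Letter) (i j : Fin N) :
    ∑ k, (∑ a, (gen c k a : Pol N G) ⊗ₜ[ℂ] (gen c a i : Pol N G)) *
      (∑ b, (gen c.flip k b : Pol N G) ⊗ₜ[ℂ] (gen c.flip b j : Pol N G))
      = if i = j then 1 else 0 := by
  simp only [Finset.sum_mul_sum, Algebra.TensorProduct.tmul_mul_tmul]
  rw [Finset.sum_comm]
  have h : ∀ a : Fin N, ∑ k, ∑ b, ((gen c k a * gen c.flip k b : Pol N G) ⊗ₜ[ℂ]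
      (gen c a i * gen c.flip b j : Pol N G)) = 1 ⊗ₜ[ℂ] (gen c a i * gen c.flip a j) := by
    intro a
    rw [Finset.sum_comm, Finset.sum_eq_single a]
    · rw [← TensorProduct.sum_tmul, gen_col, if_pos rfl]
    · intro b _ hb
      rw [← TensorProduct.sum_tmul, gen_col, if_neg hb.symm, TensorProduct.zero_tmul]
    · simp
  rw [Finset.sum_congr rfl fun a _ => h a, ← TensorProduct.tmul_sum, gen_col, tmul_delta]

/-- The coproduct. -/
def comulHom (N : ℕ) (G : Kind) : Pol N G →ₐ[ℂ] Pol N G ⊗[ℂ] Pol N G :=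
  polLift (fun c i j => ∑ k, gen c i k ⊗ₜ[ℂ] gen c k j) comul_row comul_col
    (fun h c i j => by simp only [gen_real h])

/-- The counit. -/
def counitHom (N : ℕ) (G : Kind) : Pol N G →ₐ[ℂ] ℂ :=
  polLift (fun _ i j => if i = j then 1 else 0)
    (fun c i j => by by_cases h : i = j <;> simp [h])
    (fun c i j => by by_cases h : j = i <;> simp [h, eq_comm (a := i)])
    (fun _ _ _ _ => rfl)

instance : Bialgebra ℂ (Pol N G) :=
  Bialgebra.ofAlgHom (comulHom N G) (counitHom N G)
    (pol_hom_ext fun c i j => by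
      simp only [comulHom, AlgHom.comp_apply, polLift_gen, map_sum,
        Algebra.TensorProduct.map_tmul, AlgHom.id_apply, TensorProduct.sum_tmul,
        TensorProduct.tmul_sum]
      exact Finset.sum_comm)
    (pol_hom_ext fun c i j => by
      simp only [comulHom, counitHom, AlgHom.comp_apply, polLift_gen, map_sum,
        Algebra.TensorProduct.map_tmul, AlgHom.id_apply]
      rw [Finset.sum_eq_single i (fun k _ hk => by rw [if_neg hk.symm, TensorProduct.zero_tmul])
        (by simp), if_pos rfl]
      simp)
    (pol_hom_ext fun c i j => by
      simp only [comulHom, counitHom, AlgHom.comp_apply, polLift_gen, map_sum,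
        Algebra.TensorProduct.map_tmul, AlgHom.id_apply]
      rw [Finset.sum_eq_single j (fun k _ hk => by rw [if_neg hk, TensorProduct.tmul_zero])
        (by simp), if_pos rfl]
      simp)

end

/-! Functionals on a compact quantum group, given by its `*`-algebra with coproduct and counit. -/

section Functionals

variable {A : Type*} [Ring A] [StarRing A] [Bialgebra ℂ A]

/-- Generating functionals: hermitian, vanishing on `1`, positive on the kernel of the counit. -/
structure IsGeneratingFunctional (L : A →ₗ[ℂ] ℂ) : Prop where
  hermitian : ∀ a, L (star a) = conj (L a)
  map_one : L 1 = 0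
  nonneg : ∀ a, Coalgebra.counit (R := ℂ) a = 0 → 0 ≤ L (star a * a)

/-- The Gaussian property of a functional. -/
def IsGaussian (L : A →ₗ[ℂ] ℂ) : Prop :=
  ∀ a b c : A, L (a * b * c) =
    L (a * b) * Coalgebra.counit (R := ℂ) c + L (a * c) * Coalgebra.counit (R := ℂ) b
      + L (b * c) * Coalgebra.counit (R := ℂ) a
      - Coalgebra.counit (R := ℂ) (a * b) * L c - Coalgebra.counit (R := ℂ) (a * c) * L b
      - Coalgebra.counit (R := ℂ) (b * c) * L a

/-- States: unital positive functionals. -/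
structure IsState (φ : A →ₗ[ℂ] ℂ) : Prop where
  map_one : φ 1 = 1
  nonneg : ∀ a, 0 ≤ φ (star a * a)

/-- The Haar state: `(id ⊗ h) ∘ Δ = h(·) 1 = (h ⊗ id) ∘ Δ`. -/
structure IsHaarState (h : A →ₗ[ℂ] ℂ) : Prop extends IsState h where
  right_inv : ∀ a, TensorProduct.rid ℂ A (h.lTensor A (Coalgebra.comul (R := ℂ) a)) =
    algebraMap ℂ A (h a)
  left_inv : ∀ a, TensorProduct.lid ℂ A (h.rTensor A (Coalgebra.comul (R := ℂ) a)) =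
    algebraMap ℂ A (h a)

/-- Finite-dimensional representations of the quantum group, as matrices over `A`. -/
structure IsRep {ι : Type*} [Fintype ι] [DecidableEq ι] (v : Matrix ι ι A) : Prop where
  comul : ∀ i j, Coalgebra.comul (R := ℂ) (v i j) = ∑ k, v i k ⊗ₜ[ℂ] v k j
  counit : ∀ i j, Coalgebra.counit (R := ℂ) (v i j) = if i = j then 1 else 0

/-- The central algebra: the algebra generated by the characters (traces) of the
finite-dimensional representations. -/
def centralAlgebra (A : Type*) [Ring A] [Bialgebra ℂ A] : Subalgebra ℂ A :=
  Algebra.adjoin ℂ {x | ∃ (n : ℕ) (v : Matrix (Fin n) (Fin n) A), IsRep v ∧ x = v.trace}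

/-- The conditional expectation onto the central algebra leaving the Haar state invariant.
Positivity is that of the enveloping C*-algebra, where an element is positive if and only if all
states are nonnegative on it. -/
structure IsCentralExpectation (E : A →ₗ[ℂ] A) : Prop where
  mem : ∀ a, E a ∈ centralAlgebra A
  nonneg : ∀ φ : A →ₗ[ℂ] ℂ, IsState φ → ∀ a, 0 ≤ φ (E (star a * a))
  apply_of_mem : ∀ b ∈ centralAlgebra A, E b = b
  bimodule : ∀ b ∈ centralAlgebra A, ∀ b' ∈ centralAlgebra A, ∀ a, E (b * a * b') = b * E a * b'
  haar : ∀ h : A →ₗ[ℂ] ℂ, IsHaarState h → ∀ a, h (E a) = h a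

/-- Centralized Gaussian generating functionals: the functionals `L ∘ E` with `L` a Gaussian
generating functional and `E` the conditional expectation onto the central algebra. -/
def IsCentralizedGaussian (M : A →ₗ[ℂ] ℂ) : Prop :=
  ∃ (L : A →ₗ[ℂ] ℂ) (E : A →ₗ[ℂ] A), IsGeneratingFunctional L ∧ IsGaussian L ∧
    IsCentralExpectation E ∧ M = L ∘ₗ E

end Functionals

/-! Characters. -/

/-- The characters of `O_N^+`: `χ_0 = 1`, `χ_1 = ∑ j, o_jj`, `χ_1 χ_n = χ_{n+1} + χ_{n-1}`. -/
noncomputable def orthChar (N : ℕ) : ℕ → Pol N Kind.orthogonal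
  | 0 => 1
  | 1 => ∑ j, gen Letter.plain j j
  | n + 2 => (∑ j, gen Letter.plain j j) * orthChar N (n + 1) - orthChar N n

/-- The tensor product representation `U_w = U_{w_1} ⊗ ... ⊗ U_{w_n}` of `U_N^+`, a matrix indexed
by multi-indices. -/
noncomputable def wordRep (N : ℕ) (w : List Letter) :
    Matrix (Fin w.length → Fin N) (Fin w.length → Fin N) (Pol N Kind.unitary) :=
  fun i j => (List.ofFn fun k => gen (w.get k) (i k) (j k)).prod

/-- The character of `U_w`. -/
noncomputable def wordChar (N : ℕ) (w : List Letter) : Pol N Kind.unitary := (wordRep N w).trace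

end FreeQG

/-! The conditional expectation fixes the central algebra, which contains every `orthChar` and
`wordChar`, so on these elements M is the Gaussian generating functional L itself.

Put ∂(a, b) = L(ab) - ε(a)L(b) - L(a)ε(b) (`defect`). The Gaussian identity says that ∂ is an
ε-derivation in each variable, so unitarity of the generating matrix gives ∂(a, χ̄) = -∂(a, χ) and
∂(χ̄, a) = -∂(χ, a) for the fundamental character χ. In the orthogonal case χ̄ = χ, hence ∂(χ, ·) =
0: L is an ε-derivation on polynomials in χ, with ε(χ) = N, and L(χ_n) = L(χ) P_n'(N).

In the unitary case, give a letter the sign +1 or -1 according to its type. Expanding L on a word of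
length ℓ, each letter contributes L(χ) or its conjugate times N^(ℓ-1), and each pair of letters
contributes the product of its signs times ∂(χ, χ) N^(ℓ-2). The sign products sum to ((p-q)^2 - ℓ)/2
over pairs, and ∂(χ, χ) = -∂(χ̄, χ), so α = -L(χ) and β = ∂(χ̄, χ)/2.

The inequalities come from positivity of ∂(a*, a): Cauchy–Schwarz bounds ∂(χ̄, χ) by N ∑ ∂(u_ii*,
u_ii), hence by N ∑ ∂(u_ji*, u_ji) over all entries, which equals -2N Re L(χ) by unitarity. -/

namespace FreeQG

/-! ### The defect form of a functional and the Gaussian property -/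

section Functionals

variable {A : Type*} [Ring A] [Bialgebra ℂ A]

/-- The failure of a functional to be a derivation with respect to the counit. -/
noncomputable def defect (L : A →ₗ[ℂ] ℂ) (a b : A) : ℂ :=
  L (a * b) - Coalgebra.counit (R := ℂ) a * L b - L a * Coalgebra.counit (R := ℂ) b

theorem defect_sum_left (L : A →ₗ[ℂ] ℂ) {ι : Type*} (s : Finset ι) (f : ι → A) (b : A) :
    defect L (∑ i ∈ s, f i) b = ∑ i ∈ s, defect L (f i) b := by
  simp [defect, Finset.sum_mul, Finset.sum_sub_distrib]

theorem defect_sum_right (L : A →ₗ[ℂ] ℂ) {ι : Type*} (s : Finset ι) (a : A) (f : ι → A) :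
    defect L a (∑ i ∈ s, f i) = ∑ i ∈ s, defect L a (f i) := by
  simp [defect, Finset.mul_sum, Finset.sum_sub_distrib]

theorem defect_sub_left (L : A →ₗ[ℂ] ℂ) (a a' b : A) :
    defect L (a - a') b = defect L a b - defect L a' b := by
  simp only [defect, sub_mul, map_sub]; ring

theorem defect_sub_right (L : A →ₗ[ℂ] ℂ) (a b b' : A) :
    defect L a (b - b') = defect L a b - defect L a b' := by
  simp only [defect, mul_sub, map_sub]; ring

theorem map_mul_eq_defect (L : A →ₗ[ℂ] ℂ) (a b : A) :
    L (a * b) = Coalgebra.counit (R := ℂ) a * L b + L a * Coalgebra.counit (R := ℂ) b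
      + defect L a b := by
  simp only [defect]; ring

/-- This and `defect_mul_left` are the Gaussian identity read as a Leibniz rule over the counit. -/
theorem defect_mul_right {L : A →ₗ[ℂ] ℂ} (hL : IsGaussian L) (a b c : A) :
    defect L a (b * c) =
      defect L a b * Coalgebra.counit (R := ℂ) c + Coalgebra.counit (R := ℂ) b * defect L a c := by
  simp only [defect, ← mul_assoc a b c, hL a b c, Bialgebra.counit_mul]; ring

theorem defect_mul_left {L : A →ₗ[ℂ] ℂ} (hL : IsGaussian L) (a b c : A) :
    defect L (a * b) c =
      defect L a c * Coalgebra.counit (R := ℂ) b + Coalgebra.counit (R := ℂ) a * defect L b c := by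
  simp only [defect, hL a b c, Bialgebra.counit_mul]; ring

theorem defect_one_right {L : A →ₗ[ℂ] ℂ} (h : L 1 = 0) (a : A) : defect L a 1 = 0 := by
  simp [defect, h]

theorem defect_one_left {L : A →ₗ[ℂ] ℂ} (h : L 1 = 0) (a : A) : defect L 1 a = 0 := by
  simp [defect, h]

/-- A centralized Gaussian functional agrees with a Gaussian generating functional on the central
algebra. -/
theorem IsCentralizedGaussian.exists_eqOn_central [StarRing A] {M : A →ₗ[ℂ] ℂ}
    (hM : IsCentralizedGaussian M) : ∃ L : A →ₗ[ℂ] ℂ, IsGeneratingFunctional L ∧ IsGaussian L ∧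
      ∀ a ∈ centralAlgebra A, M a = L a := by
  obtain ⟨L, E, hL, hG, hE, rfl⟩ := hM
  exact ⟨L, hL, hG, fun a ha => by rw [LinearMap.comp_apply, hE.apply_of_mem a ha]⟩

end Functionals

/-! ### Unitarity and positivity on the generators -/

section Gen

variable {N : ℕ} {G : Kind}

@[simp] theorem counit_gen (c : Letter) (i j : Fin N) :
    Coalgebra.counit (R := ℂ) (gen c i j : Pol N G) = if i = j then 1 else 0 :=
  polLift_gen _ _ _ _ c i j

theorem comul_gen (c : Letter) (i j : Fin N) :
    Coalgebra.comul (R := ℂ) (gen c i j : Pol N G) =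
      ∑ k, (gen c i k : Pol N G) ⊗ₜ[ℂ] (gen c k j : Pol N G) :=
  polLift_gen _ _ _ _ c i j

/-- The character of the fundamental representation or of its conjugate. -/
noncomputable def letterChar (N : ℕ) (G : Kind) (c : Letter) : Pol N G := ∑ j, gen c j j

theorem isRep_gen (c : Letter) : IsRep (fun i j => gen c i j : Matrix (Fin N) (Fin N) (Pol N G)) :=
  ⟨comul_gen c, counit_gen c⟩

theorem letterChar_mem_centralAlgebra (c : Letter) :
    letterChar N G c ∈ centralAlgebra (Pol N G) :=
  Algebra.subset_adjoin ⟨N, _, isRep_gen c, rfl⟩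

@[simp] theorem counit_letterChar (c : Letter) :
    Coalgebra.counit (R := ℂ) (letterChar N G c) = N := by
  simp [letterChar]

@[simp] theorem star_letterChar (c : Letter) :
    star (letterChar N G c) = letterChar N G c.flip := by
  simp [letterChar]

theorem counit_star (a : Pol N G) :
    Coalgebra.counit (R := ℂ) (star a) = conj (Coalgebra.counit (R := ℂ) a) := by
  induction a using pol_induction with
  | hc r =>
    rw [star_algebraMap_aux]
    simp
  | hg c i j => by_cases h : i = j <;> simp [h]
  | hm a b h1 h2 => rw [star_mul, Bialgebra.counit_mul, Bialgebra.counit_mul, h1, h2, map_mul,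
      mul_comm]
  | ha a b h1 h2 => simp [h1, h2]

/-- Subtracting ε(a)1 from a does not change the form, since it vanishes against scalars; on the
kernel of ε it is L(a* a). -/
theorem defect_star_self_nonneg {L : Pol N G →ₗ[ℂ] ℂ} (hL : IsGeneratingFunctional L)
    (a : Pol N G) : 0 ≤ defect L (star a) a := by
  have h := hL.nonneg (a - algebraMap ℂ _ (Coalgebra.counit (R := ℂ) a)) (by simp)
  convert h using 1
  rw [map_mul_eq_defect L (star _), star_sub, star_algebraMap_aux, defect_sub_left,
    defect_sub_right, defect_sub_right]
  simp [Algebra.algebraMap_eq_smul_one, defect, hL.map_one, counit_star,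
    mul_comm]

variable {L : Pol N G →ₗ[ℂ] ℂ}

/-- Applying the derivation ∂(a, ·) to the relation ∑ u_ik u_jk* = δ_ij kills the right side, and
the counits leave one term from each factor on the left. -/
theorem defect_gen_flip_right (hL : IsGeneratingFunctional L) (hG : IsGaussian L) (a : Pol N G)
    (c : Letter) (i j : Fin N) : defect L a (gen c.flip j i) = -defect L a (gen c i j) := by
  have h := congrArg (defect L a) (gen_row (G := G) c i j)
  have h1 : defect L a (if i = j then 1 else 0) = 0 := by
    split_ifs
    · exact defect_one_right hL.map_one a
    · simp [defect]
  rw [h1, defect_sum_right] at h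
  simp only [defect_mul_right hG, counit_gen, mul_ite, ite_mul, mul_one, one_mul, mul_zero,
    zero_mul, Finset.sum_add_distrib, Finset.sum_ite_eq, Finset.mem_univ, if_true] at h
  linear_combination h

theorem defect_gen_flip_left (hL : IsGeneratingFunctional L) (hG : IsGaussian L) (a : Pol N G)
    (c : Letter) (i j : Fin N) : defect L (gen c.flip j i) a = -defect L (gen c i j) a := by
  have h := congrArg (fun x => defect L x a) (gen_row (G := G) c i j)
  have h1 : defect L (if i = j then 1 else 0) a = 0 := by
    split_ifs
    · exact defect_one_left hL.map_one a
    · simp [defect]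
  simp only [h1, defect_sum_left] at h
  simp only [defect_mul_left hG, counit_gen, mul_ite, ite_mul, mul_one, one_mul, mul_zero,
    zero_mul, Finset.sum_add_distrib, Finset.sum_ite_eq, Finset.mem_univ, if_true] at h
  linear_combination h

theorem defect_letterChar_flip_right (hL : IsGeneratingFunctional L) (hG : IsGaussian L)
    (a : Pol N G) (c : Letter) :
    defect L a (letterChar N G c.flip) = -defect L a (letterChar N G c) := by
  simp only [letterChar, defect_sum_right, ← Finset.sum_neg_distrib,
    defect_gen_flip_right hL hG]

theorem defect_letterChar_flip_left (hL : IsGeneratingFunctional L) (hG : IsGaussian L)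
    (a : Pol N G) (c : Letter) :
    defect L (letterChar N G c.flip) a = -defect L (letterChar N G c) a := by
  simp only [letterChar, defect_sum_left, ← Finset.sum_neg_distrib,
    defect_gen_flip_left hL hG]

theorem map_letterChar_flip (hL : IsGeneratingFunctional L) (c : Letter) :
    L (letterChar N G c.flip) = conj (L (letterChar N G c)) := by
  rw [← star_letterChar, hL.hermitian]

/-- For fixed i the products sum to 1, where L vanishes, so only the two counit terms at j = i
survive. -/
theorem sum_defect_gen (hL : IsGeneratingFunctional L) (c : Letter) :
    ∑ i, ∑ j, defect L (gen c.flip j i) (gen c j i) =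
      -(L (letterChar N G c.flip) + L (letterChar N G c)) := by
  have h : ∀ i : Fin N, ∑ j, defect L (gen c.flip j i) (gen c j i) =
      -(L (gen c.flip i i) + L (gen c i i)) := by
    intro i
    have h := congrArg L (gen_col (G := G) c.flip i i)
    rw [if_pos rfl, hL.map_one, map_sum, Letter.flip_flip] at h
    simp only [defect, Finset.sum_sub_distrib, h, counit_gen, ite_mul, mul_ite, one_mul, mul_one,
      zero_mul, mul_zero, Finset.sum_ite_eq', Finset.mem_univ, if_true]
    ring
  simp only [h, letterChar, map_sum, Finset.sum_neg_distrib, Finset.sum_add_distrib]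

/-- The Cauchy–Schwarz inequality for the diagonal generators. -/
theorem defect_letterChar_le (hL : IsGeneratingFunctional L) (c : Letter) :
    defect L (letterChar N G c.flip) (letterChar N G c) ≤
      N * ∑ i, defect L (gen c.flip i i) (gen c i i) := by
  -- Lagrange's identity: this double sum is twice the right side of the claim minus its left side.
  have h : 0 ≤ ∑ i : Fin N, ∑ j : Fin N,
      defect L (star (gen c i i - gen c j j)) (gen c i i - gen c j j) :=
    Finset.sum_nonneg fun i _ => Finset.sum_nonneg fun j _ => defect_star_self_nonneg hL _
  simp only [star_sub, star_gen, defect_sub_left, defect_sub_right, Finset.sum_sub_distrib,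
    Finset.sum_const, Finset.card_univ, Fintype.card_fin, nsmul_eq_mul, ← Finset.mul_sum] at h
  have e1 : ∑ i : Fin N, ∑ j : Fin N, defect L (gen c.flip i i) (gen c j j) =
      defect L (letterChar N G c.flip) (letterChar N G c) := by
    simp only [letterChar, defect_sum_left, defect_sum_right]
    exact Finset.sum_comm
  have e2 : ∑ i : Fin N, ∑ j : Fin N, defect L (gen c.flip j j) (gen c i i) =
      defect L (letterChar N G c.flip) (letterChar N G c) := by
    rw [Finset.sum_comm, e1]
  rw [e1, e2] at h
  rw [← sub_nonneg]
  have h2 : (0 : ℂ) ≤ 1 / 2 := by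
    rw [Complex.le_def]; norm_num
  have h3 := mul_nonneg h2 h
  convert h3 using 1
  ring

theorem defect_letterChar_le_neg (hL : IsGeneratingFunctional L) (c : Letter) :
    defect L (letterChar N G c.flip) (letterChar N G c) ≤
      N * -(L (letterChar N G c.flip) + L (letterChar N G c)) := by
  refine (defect_letterChar_le hL c).trans ?_
  rw [← sum_defect_gen hL c]
  refine mul_le_mul_of_nonneg_left ?_ (Nat.cast_nonneg N)
  -- The diagonal term is one of the nonnegative terms of the sum over j.
  refine Finset.sum_le_sum fun i _ => ?_
  refine Finset.single_le_sum (f := fun j => defect L (gen c.flip j i) (gen c j i))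
    (fun j _ => ?_) (Finset.mem_univ i)
  have h := defect_star_self_nonneg hL (gen c j i)
  rwa [star_gen] at h

theorem defect_letterChar_nonneg (hL : IsGeneratingFunctional L) (c : Letter) :
    0 ≤ defect L (letterChar N G c.flip) (letterChar N G c) := by
  have h := defect_star_self_nonneg hL (letterChar N G c)
  rwa [star_letterChar] at h

end Gen

/-! ### Characters of the free orthogonal quantum group -/

section Orthogonal

variable {N : ℕ}

theorem orthChar_mem_centralAlgebra (n : ℕ) :
    orthChar N n ∈ centralAlgebra (Pol N Kind.orthogonal) := by
  induction n using Nat.twoStepInduction with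
  | zero => exact one_mem _
  | one => exact letterChar_mem_centralAlgebra Letter.plain
  | more n h0 h1 =>
    exact sub_mem (mul_mem (letterChar_mem_centralAlgebra Letter.plain) h1) h0

theorem orthChar_add_two (n : ℕ) : orthChar N (n + 2) =
    letterChar N Kind.orthogonal Letter.plain * orthChar N (n + 1) - orthChar N n := rfl

theorem counit_orthChar (n : ℕ) : Coalgebra.counit (R := ℂ) (orthChar N n) =
    (((Polynomial.Chebyshev.S ℝ (n : ℤ)).eval (N : ℝ) : ℝ) : ℂ) := by
  induction n using Nat.twoStepInduction with
  | zero => simp [orthChar]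
  | one => simp [orthChar]
  | more n h0 h1 =>
    rw [orthChar_add_two, map_sub, Bialgebra.counit_mul, h0, h1, counit_letterChar]
    push_cast
    rw [Polynomial.Chebyshev.S_add_two]
    simp

theorem letterChar_orthogonal (c : Letter) :
    letterChar N Kind.orthogonal c.flip = letterChar N Kind.orthogonal c := by
  simp only [letterChar, gen_real rfl]

theorem map_orthChar {L : Pol N Kind.orthogonal →ₗ[ℂ] ℂ} (hL : IsGeneratingFunctional L)
    (hG : IsGaussian L) (n : ℕ) : L (orthChar N n) =
      L (letterChar N Kind.orthogonal Letter.plain) *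
        (((Polynomial.derivative (Polynomial.Chebyshev.S ℝ (n : ℤ))).eval (N : ℝ) : ℝ) : ℂ) := by
  -- The character is self-conjugate, so conjugation both fixes the form and changes its sign.
  have hd (a : Pol N Kind.orthogonal) :
      defect L (letterChar N Kind.orthogonal Letter.plain) a = 0 := by
    have h := defect_letterChar_flip_left hL hG a Letter.plain
    rw [letterChar_orthogonal] at h
    exact self_eq_neg.mp h
  induction n using Nat.twoStepInduction with
  | zero => simp [orthChar, hL.map_one]
  | one => simp [orthChar, letterChar]
  | more n h0 h1 =>
    rw [orthChar_add_two, map_sub, map_mul_eq_defect, hd, h0, h1, counit_letterChar,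
      counit_orthChar]
    push_cast
    rw [Polynomial.Chebyshev.S_add_two]
    simp
    ring

theorem map_orthChar_of_isCentralizedGaussian (hN : 1 ≤ N) {M : Pol N Kind.orthogonal →ₗ[ℂ] ℂ}
    (hM : IsCentralizedGaussian M) : ∃ b : ℝ, 0 ≤ b ∧ ∀ n : ℕ, M (orthChar N n) =
      ((-b * (Polynomial.derivative (Polynomial.Chebyshev.S ℝ (n : ℤ))).eval (N : ℝ) : ℝ) : ℂ) := by
  obtain ⟨L, hL, hG, hML⟩ := hM.exists_eqOn_central
  set x := L (letterChar N Kind.orthogonal Letter.plain) with hx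
  have hreal : conj x = x := by
    rw [hx, ← map_letterChar_flip hL, letterChar_orthogonal]
  have hre : ((x.re : ℝ) : ℂ) = x := Complex.conj_eq_iff_re.mp hreal
  refine ⟨-x.re, ?_, fun n => ?_⟩
  -- The two bounds on the form combine to 0 ≤ -2N L(χ), whence L(χ) ≤ 0.
  · have h := (defect_letterChar_nonneg hL Letter.plain).trans
      (defect_letterChar_le_neg hL Letter.plain)
    rw [letterChar_orthogonal, ← hx, ← hre] at h
    norm_cast at h
    have hN' : (0 : ℝ) < N := by exact_mod_cast hN
    have := nonneg_of_mul_nonneg_right h hN'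
    linarith
  · rw [hML _ (orthChar_mem_centralAlgebra n), map_orthChar hL hG, ← hx, neg_neg]
    push_cast
    rw [hre]

end Orthogonal

/-! ### Word characters of the free unitary quantum group -/

section Unitary

variable {N : ℕ}

theorem length_eq_count_add_count (w : List Letter) :
    w.length = w.count Letter.plain + w.count Letter.bar := by
  induction w with
  | nil => rfl
  | cons c w ih => cases c <;> simp [ih] <;> ring

theorem wordChar_nil : wordChar N [] = 1 := by
  simp [wordChar, wordRep, Matrix.trace]

theorem wordChar_cons (c : Letter) (w : List Letter) :
    wordChar N (c :: w) = letterChar N Kind.unitary c * wordChar N w := by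
  have h := (Fin.consEquiv (fun _ : Fin (w.length + 1) => Fin N)).sum_comp
    (fun i : Fin (w.length + 1) → Fin N => wordRep N (c :: w) i i)
  rw [wordChar, Matrix.trace]
  refine h.symm.trans ?_
  rw [Fintype.sum_prod_type, letterChar, wordChar, Matrix.trace, Finset.sum_mul_sum]
  refine Finset.sum_congr rfl fun i _ => Finset.sum_congr rfl fun j _ => ?_
  simp [wordRep, List.ofFn_succ, Fin.consEquiv]

theorem wordChar_mem_centralAlgebra (w : List Letter) :
    wordChar N w ∈ centralAlgebra (Pol N Kind.unitary) := by
  induction w with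
  | nil => rw [wordChar_nil]; exact one_mem _
  | cons c w ih => rw [wordChar_cons]; exact mul_mem (letterChar_mem_centralAlgebra c) ih

theorem counit_wordChar (w : List Letter) :
    Coalgebra.counit (R := ℂ) (wordChar N w) = (N : ℂ) ^ w.length := by
  induction w with
  | nil => simp [wordChar_nil]
  | cons c w ih => rw [wordChar_cons, Bialgebra.counit_mul, ih, counit_letterChar, List.length_cons,
      pow_succ']

variable {L : Pol N Kind.unitary →ₗ[ℂ] ℂ}

/-- A derivation over ε sees each letter once, with its sign, while the other ℓ - 1 letters
contribute N each. For the empty word the exponent is -1 but the coefficient is 0. -/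
theorem defect_wordChar (hN : 1 ≤ N) (hL : IsGeneratingFunctional L) (hG : IsGaussian L)
    (a : Pol N Kind.unitary) (w : List Letter) : defect L a (wordChar N w) =
      ((w.count Letter.plain : ℂ) - (w.count Letter.bar : ℂ)) * (N : ℂ) ^ ((w.length : ℤ) - 1) *
        defect L a (letterChar N Kind.unitary Letter.plain) := by
  have hN' : (N : ℂ) ≠ 0 := by exact_mod_cast (by omega : N ≠ 0)
  induction w with
  | nil => simp [wordChar_nil, defect_one_right hL.map_one]
  | cons c w ih =>
    rw [wordChar_cons, defect_mul_right hG, ih, counit_wordChar, counit_letterChar]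
    have hb : defect L a (letterChar N Kind.unitary Letter.bar) =
      -defect L a (letterChar N Kind.unitary Letter.plain) :=
      defect_letterChar_flip_right hL hG a Letter.plain
    cases c <;> simp [hb, zpow_sub_one₀ hN'] <;> field_simp <;> ring

/-- Adding a letter of sign s in front of a word adds the pair term s(p - q)∂(χ, χ), matching the
growth of ((p-q)^2 - ℓ)/2 when p - q becomes p - q + s. The coefficients vanish whenever the
exponents are negative. -/
theorem map_wordChar (hN : 1 ≤ N) (hL : IsGeneratingFunctional L) (hG : IsGaussian L)
    (w : List Letter) : L (wordChar N w) =
      ((w.count Letter.plain : ℂ) * L (letterChar N Kind.unitary Letter.plain)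
        + (w.count Letter.bar : ℂ) * conj (L (letterChar N Kind.unitary Letter.plain)))
        * (N : ℂ) ^ ((w.length : ℤ) - 1)
      - (((w.count Letter.plain : ℂ) - (w.count Letter.bar : ℂ)) ^ 2 - (w.length : ℂ))
        * (N : ℂ) ^ ((w.length : ℤ) - 2)
        * (defect L (letterChar N Kind.unitary Letter.bar)
            (letterChar N Kind.unitary Letter.plain) / 2) := by
  have hN' : (N : ℂ) ≠ 0 := by exact_mod_cast (by omega : N ≠ 0)
  have hc : L (letterChar N Kind.unitary Letter.bar) =
    conj (L (letterChar N Kind.unitary Letter.plain)) := map_letterChar_flip hL Letter.plain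
  have hd (a : Pol N Kind.unitary) : defect L (letterChar N Kind.unitary Letter.bar) a =
    -defect L (letterChar N Kind.unitary Letter.plain) a :=
    defect_letterChar_flip_left hL hG a Letter.plain
  have hz (n : ℕ) : (N : ℂ) ^ ((n : ℤ) - 2) = (N : ℂ) ^ n / (N : ℂ) ^ 2 := by
    rw [zpow_sub₀ hN']; norm_cast
  induction w with
  | nil => simp [wordChar_nil, hL.map_one]
  | cons c w ih =>
    rw [wordChar_cons, map_mul_eq_defect, ih, counit_wordChar, counit_letterChar,
      defect_wordChar hN hL hG, hz, hz, List.length_cons]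
    cases c <;> simp [hc, hd, zpow_sub_one₀ hN', pow_succ] <;> field_simp <;> ring

theorem map_wordChar_of_isCentralizedGaussian (hN : 1 ≤ N) {M : Pol N Kind.unitary →ₗ[ℂ] ℂ}
    (hM : IsCentralizedGaussian M) : ∃ (α : ℂ) (β : ℝ), 0 ≤ β ∧ β / (N : ℝ) ≤ α.re ∧
      ∀ w : List Letter, M (wordChar N w) =
        -((w.count Letter.plain : ℂ) * α + (w.count Letter.bar : ℂ) * conj α)
            * (N : ℂ) ^ ((w.length : ℤ) - 1)
          - (((w.count Letter.plain : ℂ) - (w.count Letter.bar : ℂ)) ^ 2 - (w.length : ℂ))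
            * (N : ℂ) ^ ((w.length : ℤ) - 2) * (β : ℂ) := by
  obtain ⟨L, hL, hG, hML⟩ := hM.exists_eqOn_central
  have h0 := defect_letterChar_nonneg hL Letter.plain
  have h1 := defect_letterChar_le_neg hL Letter.plain
  rw [map_letterChar_flip hL] at h1
  change 0 ≤ defect L (letterChar N Kind.unitary Letter.bar) _ at h0
  change defect L (letterChar N Kind.unitary Letter.bar) _ ≤ _ at h1
  have hw := map_wordChar hN hL hG
  set x := L (letterChar N Kind.unitary Letter.plain)
  set y := defect L (letterChar N Kind.unitary Letter.bar) (letterChar N Kind.unitary Letter.plain)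
  have hy : ((y.re : ℝ) : ℂ) = y := Complex.ext rfl (Complex.nonneg_iff.mp h0).2
  have h0' : 0 ≤ y.re := (Complex.nonneg_iff.mp h0).1
  -- The half is there because each unordered pair of letters counts twice in (p-q)^2 - ℓ.
  refine ⟨-x, y.re / 2, by positivity, ?_, fun w => ?_⟩
  · have h2 := (Complex.le_def.mp h1).1
    have hN' : (0 : ℝ) < N := by exact_mod_cast hN
    rw [div_le_iff₀ hN']
    simp at h2 ⊢
    linarith
  · rw [hML _ (wordChar_mem_centralAlgebra w), hw]
    push_cast
    rw [hy, map_neg]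
    ring

end Unitary

end FreeQG

theorem propositionB (N : ℕ) (hN : 1 ≤ N) :
    (∀ M : FreeQG.Pol N FreeQG.Kind.orthogonal →ₗ[ℂ] ℂ, FreeQG.IsCentralizedGaussian M →
      ∃ b : ℝ, 0 ≤ b ∧ ∀ n : ℕ, M (FreeQG.orthChar N n) =
        ((-b * (Polynomial.derivative (Polynomial.Chebyshev.S ℝ (n : ℤ))).eval (N : ℝ) : ℝ) : ℂ)) ∧
    (∀ M : FreeQG.Pol N FreeQG.Kind.unitary →ₗ[ℂ] ℂ, FreeQG.IsCentralizedGaussian M →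
      ∃ (α : ℂ) (β : ℝ), 0 ≤ β ∧ β / (N : ℝ) ≤ α.re ∧
        (∀ w : List FreeQG.Letter, M (FreeQG.wordChar N w) =
          -((w.count FreeQG.Letter.plain : ℂ) * α
              + (w.count FreeQG.Letter.bar : ℂ) * (starRingEnd ℂ) α)
              * (N : ℂ) ^ ((w.length : ℤ) - 1)
            - (((w.count FreeQG.Letter.plain : ℂ) - (w.count FreeQG.Letter.bar : ℂ)) ^ 2
                - (w.length : ℂ)) * (N : ℂ) ^ ((w.length : ℤ) - 2) * (β : ℂ)) ∧
        ((∀ w : List FreeQG.Letter, (M (FreeQG.wordChar N w)).im = 0) →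
          α.im = 0 ∧ ∀ w : List FreeQG.Letter, M (FreeQG.wordChar N w) =
            -(w.length : ℂ) * (N : ℂ) ^ ((w.length : ℤ) - 1) * α
            - (((w.count FreeQG.Letter.plain : ℂ) - (w.count FreeQG.Letter.bar : ℂ)) ^ 2
                - (w.length : ℂ)) * (N : ℂ) ^ ((w.length : ℤ) - 2) * (β : ℂ))) := by
  refine ⟨fun M hM => FreeQG.map_orthChar_of_isCentralizedGaussian hN hM, fun M hM => ?_⟩
  obtain ⟨α, β, hβ, hαβ, hw⟩ := FreeQG.map_wordChar_of_isCentralizedGaussian hN hM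
  refine ⟨α, β, hβ, hαβ, hw, fun hreal => ?_⟩
  have hα : α.im = 0 := by
    -- On a one-letter word (p-q)^2 = ℓ, so the value is -α alone.
    have h := hreal [FreeQG.Letter.plain]
    rw [hw] at h
    simpa using h
  refine ⟨hα, fun w => ?_⟩
  rw [hw, Complex.conj_eq_iff_im.mpr hα, FreeQG.length_eq_count_add_count w]
  push_cast
  ring
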